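/- Let $0<\lambda_1<1<\lambda_2$ and $t>0$ satisfy $\frac{\lambda_1^t+\lambda_2^t}{2}<1$. Then $\lambda_1\lambda_2<1$, and for every real $\epsilon$ with $\lambda_1+\epsilon>0$ and $(\lambda_1+\epsilon)\lambda_2<1$ there is exactly one Borel probability measure $\mu=\mu_{\lambda_1+\epsilon,\lambda_2}$ on $\mathbb{R}$ with $\mu=\frac12 (f_1)_*\mu+\frac12 (f_2)_*\mu$, where $f_1(x)=(\lambda_1+\epsilon)x+1$ and $f_2(x)=\lambda_2x+1$. Let $\nu=(\frac12,\frac12)^{\mathbb{N}}$ be the Bernoulli measure on $\Sigma=\{1,2\}^{\mathbb{N}}$, put $\lambda_1(\epsilon)=\lambda_1+\epsilon$, $\lambda_2(\epsilon)=\lambda_2$, and for $(i_1,i_2,\dots)\in\Sigma$ let $$X(\epsilon)=\sum_{m=0}^{\infty}\lambda_{i_1}(\epsilon)\cdots\lambda_{i_m}(\epsilon),\quad X=X(0),\quad X^{(j)}=\frac{j!}{\lambda_1^j}\sum_{m=1}^{\infty}\lambda_{i_1}\cdots\lambda_{i_m}\binom{o(m)}{j}\quad(j\ge1),$$ where $o(m)$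 is the number of $1$'s among $i_1,\dots,i_m$. For $\nu$-almost every word, the series for $X(\epsilon)$ converges for all $\epsilon$ with $\lambda_1+\epsilon>0$ and $(\lambda_1+\epsilon)\lambda_2<1$, the series for all $X^{(j)}$ converge, $\epsilon\mapsto X(\epsilon)$ is infinitely differentiable at $0$, and $\frac{d^j}{d\epsilon^j}X(\epsilon)|_{\epsilon=0}=X^{(j)}$ for all $j\ge1$. Let $\phi(x)=x^t$. For all sufficiently small $|\epsilon|$ the measure $\mu_{\lambda_1+\epsilon,\lambda_2}$ is concentrated on $[1,\infty)$ and $h(\epsilon)=\int\phi\,d\mu_{\lambda_1+\epsilon,\lambda_2}$ is finite. The function $h$ is infinitely differentiable at $0$, and for every integer $l\ge0$ $$h^{(l)}(0)=\int_\Sigma\frac{d^l}{d\epsilon^l}\phi(X(\epsilon))\Big|_{\epsilon=0}\,d\nu=\int_\Sigma\ \sum_{k_1+2k_2+\cdots+lk_l=l}L(k_1,\dots,k_l)\,\phi^{(k)}(X)\prod_{j=1}^{l}\bigl(X^{(j)}\bigr)^{k_j}\,d\nu ,$$ where the sum is over non-negative integers $k_1,\dots,k_l$, $k=k_1+\cdots+k_l$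 and $L(k_1,\dots,k_l)=\frac{l!}{k_1!(1!)^{k_1}\cdots k_l!(l!)^{k_l}}$; the two integrands are equal $\nu$-almost everywhere and $\nu$-integrable. -/

import Mathlib

open MeasureTheory Filter Topology
open scoped ContDiff

noncomputable section

namespace LinearResponse

/-- `μ` is a stationary measure of the IFS `f_i (x) = lam i * x + 1` (`i = 0, 1`), each map being
chosen with probability `1/2`: a Borel probability measure with `μ = ∑ i, (1/2) (f_i)_* μ`.
The letters `1, 2` are represented by `0, 1 : Fin 2`. -/
def IsStationary (lam : Fin 2 → ℝ) (μ : Measure ℝ) : Prop :=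
  IsProbabilityMeasure μ ∧
    μ = ∑ i : Fin 2, (2⁻¹ : ENNReal) • μ.map (fun x => lam i * x + 1)

/-- The Bernoulli measure `(1/2, 1/2)^ℕ` on the space of infinite words `ℕ → Fin 2`. -/
def bernoulli : Measure (ℕ → Fin 2) :=
  Measure.infinitePi fun _ : ℕ => (PMF.uniformOfFintype (Fin 2)).toMeasure

/-- The product of the ratios of the first `m` letters of the word `w`. -/
def weight (lam : Fin 2 → ℝ) (w : ℕ → Fin 2) (m : ℕ) : ℝ :=
  ∏ k ∈ Finset.range m, lam (w k)

/-- The number of occurrences of the first letter among the first `m` letters of `w`. -/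
def firstCount (w : ℕ → Fin 2) (m : ℕ) : ℕ :=
  ((Finset.range m).filter fun k => w k = 0).card

/-- The symbolic projection `∑_{m ≥ 0} lam_{i_1} ⋯ lam_{i_m}`. -/
def X (lam : Fin 2 → ℝ) (w : ℕ → Fin 2) : ℝ :=
  ∑' m : ℕ, weight lam w m

/-- The formal `j`-th derivative (for `j ≥ 1`) of `X` in the first ratio,
`j! / lam_1 ^ j * ∑_{m ≥ 1} lam_{i_1} ⋯ lam_{i_m} * (o(m) choose j)`. -/
def XDeriv (lam : Fin 2 → ℝ) (j : ℕ) (w : ℕ → Fin 2) : ℝ :=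
  (j.factorial : ℝ) / lam 0 ^ j *
    ∑' m : ℕ, weight lam w (m + 1) * ((firstCount w (m + 1)).choose j : ℝ)

/-- The tuples `(k_1, …, k_l)` of natural numbers with `k_1 + 2 k_2 + ⋯ + l k_l = l`;
the entry `k_j` is `k (j - 1)`. -/
def tuples (l : ℕ) : Finset (Fin l → ℕ) :=
  (Fintype.piFinset fun _ : Fin l => Finset.range (l + 1)).filter
    fun k => ∑ j : Fin l, ((j : ℕ) + 1) * k j = l

theorem mem_tuples (l : ℕ) (k : Fin l → ℕ) :
    k ∈ tuples l ↔ ∑ j : Fin l, ((j : ℕ) + 1) * k j = l := by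
  simp only [tuples, Finset.mem_filter, Fintype.mem_piFinset, Finset.mem_range,
    and_iff_right_iff_imp]
  intro h j
  have h1 : ((j : ℕ) + 1) * k j ≤ ∑ j : Fin l, ((j : ℕ) + 1) * k j :=
    Finset.single_le_sum (f := fun j : Fin l => ((j : ℕ) + 1) * k j)
      (fun _ _ => Nat.zero_le _) (Finset.mem_univ j)
  nlinarith [Nat.zero_le ((j : ℕ) * k j)]

/-- The coefficient `l! / (k_1! (1!)^{k_1} ⋯ k_l! (l!)^{k_l})`. -/
def coeffL (l : ℕ) (k : Fin l → ℕ) : ℝ :=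
  (l.factorial : ℝ) /
    ∏ j : Fin l, ((k j).factorial : ℝ) * ((((j : ℕ) + 1).factorial : ℝ)) ^ k j

/-- The formal `l`-th derivative of `φ ∘ X` in the first ratio. -/
def formalDeriv (φ : ℝ → ℝ) (lam : Fin 2 → ℝ) (l : ℕ) (w : ℕ → Fin 2) : ℝ :=
  ∑ k ∈ tuples l,
    coeffL l k * iteratedDeriv (∑ j : Fin l, k j) φ (X lam w) *
      ∏ j : Fin l, XDeriv lam ((j : ℕ) + 1) w ^ k j

end LinearResponse

end

/-! The stationary measure is the law of `X` under `bernoulli`, so `h(ε)` is an expectation of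
`X(ε)^t`. For almost every word, `X` is a power series in the first ratio with nonnegative Taylor
coefficients (binomial theorem and Tonelli), and Faà di Bruno's formula identifies the derivatives
of `X^t` with `formalDeriv`. It remains to differentiate under the integral.

The difficulty is domination. Since the second ratio exceeds 1, `X` can have heavy tails, and the
hypothesis controls only moments of order slightly above `t`. The terms of the `l`-th derivative
have size `X(c)^(t-k) * X(c+ρ)^k` with `k ≤ l`, and bounding numerator and denominator separately
would require moments of order `k`. But `X` is log-convex in the logarithm of the first ratio
(`X_le_rpow_mul_rpow`, by Hölder), whence `X(c+ρ)/X(c) ≤ X(c')^θ` with `θ` as small as desired for a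
suitable `ρ`. Every derivative is therefore bounded by a constant times `X(c')^(t+p)` for a fixed
`c'` and a small `p` (`exists_abs_formalDeriv_le_uniform`), and this is integrable because the
moment condition is open (`exists_pos_moment_lt`, `ae_summable_weight_and_integrable_X_rpow`). -/

namespace LinearResponse

/-! ### Taylor polynomials and Faà di Bruno's formula -/

/-- An analytic function minus its Taylor polynomial of degree `n` is divisible by `h ^ (n + 1)`. -/
theorem exists_taylor_remainder {f : ℝ → ℝ} {x : ℝ} (hf : AnalyticAt ℝ f x) (n : ℕ) :
    ∃ r : ℝ → ℝ, AnalyticAt ℝ r 0 ∧ ∀ᶠ h in 𝓝 (0 : ℝ),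
      f (x + h) = ∑ k ∈ Finset.range (n + 1), iteratedDeriv k f x / k.factorial * h ^ k +
        h ^ (n + 1) * r h := by
  have hg : AnalyticAt ℝ (fun h => f (x + h)) 0 := by
    apply AnalyticAt.fun_comp (by simpa using hf)
    fun_prop
  have hp : ∀ k : ℕ, AnalyticAt ℝ (fun h : ℝ => iteratedDeriv k f x / k.factorial * h ^ k) 0 :=
    fun k => by fun_prop
  have hP : AnalyticAt ℝ (fun h : ℝ => ∑ k ∈ Finset.range (n + 1),
      iteratedDeriv k f x / k.factorial * h ^ k) 0 := by fun_prop
  have hd := hg.fun_sub hP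
  have key : ((n + 1 : ℕ) : ℕ∞) ≤ analyticOrderAt (fun h => f (x + h) -
      ∑ k ∈ Finset.range (n + 1), iteratedDeriv k f x / k.factorial * h ^ k) 0 := by
    rw [natCast_le_analyticOrderAt_iff_iteratedDeriv_eq_zero hd]
    intro i hi
    rw [iteratedDeriv_fun_sub hg.contDiffAt hP.contDiffAt,
      iteratedDeriv_fun_sum (fun k _ => (hp k).contDiffAt), iteratedDeriv_comp_const_add]
    have : ∀ k ∈ Finset.range (n + 1),
        iteratedDeriv i (fun h : ℝ => iteratedDeriv k f x / k.factorial * h ^ k) 0 =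
          if i = k then iteratedDeriv k f x else 0 := by
      intro k _
      rw [iteratedDeriv_const_mul_field, iteratedDeriv_fun_pow_zero]
      split_ifs with h
      · field_simp
      · simp
    rw [Finset.sum_congr rfl this, Finset.sum_ite_eq, if_pos (by simpa using hi)]
    simp
  obtain ⟨r, hr, h⟩ := (natCast_le_analyticOrderAt hd).1 key
  refine ⟨r, hr, h.mono fun z hz => ?_⟩
  simp only [sub_zero, smul_eq_mul] at hz
  linarith

theorem iteratedDeriv_eq_zero_of_eventually_eq_pow_mul {G g : ℝ → ℝ} {n i : ℕ}
    (hG : AnalyticAt ℝ G 0) (hg : AnalyticAt ℝ g 0)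
    (h : ∀ᶠ z in 𝓝 (0 : ℝ), G z = z ^ n * g z) (hi : i < n) : iteratedDeriv i G 0 = 0 := by
  refine (natCast_le_analyticOrderAt_iff_iteratedDeriv_eq_zero hG).1 ?_ i hi
  exact (natCast_le_analyticOrderAt hG).2 ⟨g, hg, by simpa using h⟩

/-- The `l`-th derivative of a composition depends only on the Taylor polynomials. -/
theorem iteratedDeriv_comp_eq_iteratedDeriv_taylor {φ f : ℝ → ℝ} {x : ℝ} (hf : AnalyticAt ℝ f x)
    (hφ : AnalyticAt ℝ φ (f x)) (l : ℕ) :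
    iteratedDeriv l (fun y => φ (f y)) x = iteratedDeriv l (fun h : ℝ =>
      ∑ k ∈ Finset.range (l + 1), iteratedDeriv k φ (f x) / k.factorial *
        (∑ j : Fin l, iteratedDeriv ((j : ℕ) + 1) f x / (((j : ℕ) + 1).factorial : ℝ) *
          h ^ ((j : ℕ) + 1)) ^ k) 0 := by
  obtain ⟨r, hr, hfr⟩ := exists_taylor_remainder hf l
  obtain ⟨s, hs, hφs⟩ := exists_taylor_remainder hφ l
  set a : ℕ → ℝ := fun k => iteratedDeriv k φ (f x) / k.factorial with ha
  set P : ℝ → ℝ := fun h => ∑ j : Fin l, iteratedDeriv ((j : ℕ) + 1) f x /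
    (((j : ℕ) + 1).factorial : ℝ) * h ^ ((j : ℕ) + 1) with hPdef
  -- `P` is `h` times `Q`, so the `(l + 1)`-st power of the increment of `f` is divisible by `h ^ (l
  -- + 1)`.
  set Q : ℝ → ℝ := fun h => ∑ j : Fin l, iteratedDeriv ((j : ℕ) + 1) f x /
    (((j : ℕ) + 1).factorial : ℝ) * h ^ (j : ℕ) with hQdef
  have hPQ : ∀ h, P h = h * Q h := by
    intro h
    simp only [hPdef, hQdef, Finset.mul_sum]
    exact Finset.sum_congr rfl fun j _ => by ring
  have hP : AnalyticAt ℝ P 0 := by fun_prop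
  have hQ : AnalyticAt ℝ Q 0 := by fun_prop
  have hU : ∀ᶠ h in 𝓝 (0 : ℝ), f (x + h) = f x + (P h + h ^ (l + 1) * r h) := by
    filter_upwards [hfr] with h hh
    rw [hh, Finset.sum_range_succ', Finset.sum_range, add_assoc, add_comm]
    simp [hPdef]
    ring
  have hU0 : Tendsto (fun h => P h + h ^ (l + 1) * r h) (𝓝 0) (𝓝 0) := by
    have : ContinuousAt (fun h => P h + h ^ (l + 1) * r h) 0 :=
      (AnalyticAt.fun_add hP (by fun_prop)).continuousAt
    simpa [ContinuousAt, hPQ] using this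
  have hUa : AnalyticAt ℝ (fun h => P h + h ^ (l + 1) * r h) 0 := by fun_prop
  have hsU : AnalyticAt ℝ (fun h => s (P h + h ^ (l + 1) * r h)) 0 := by
    refine AnalyticAt.fun_comp ?_ hUa
    simpa [hPQ] using hs
  have hg : AnalyticAt ℝ (fun h => f (x + h)) 0 :=
    AnalyticAt.fun_comp (by simpa using hf) (by fun_prop)
  have hφf : AnalyticAt ℝ (fun h => φ (f (x + h))) 0 :=
    AnalyticAt.fun_comp (by simpa using hφ) hg
  have hT : AnalyticAt ℝ (fun h => ∑ k ∈ Finset.range (l + 1), a k * P h ^ k) 0 := by fun_prop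
  have e1 : iteratedDeriv l (fun y => φ (f y)) x = iteratedDeriv l (fun h => φ (f (x + h))) 0 := by
    rw [iteratedDeriv_comp_const_add l (fun y => φ (f y)) x]
    simp
  rw [e1, ← sub_eq_zero, ← iteratedDeriv_fun_sub hφf.contDiffAt hT.contDiffAt]
  -- The first summand of `g` comes from replacing the increment of `f` by `P` in each power
  -- (factorization of `u ^ k - v ^ k`); the second is the Taylor remainder of `φ`.
  refine iteratedDeriv_eq_zero_of_eventually_eq_pow_mul (n := l + 1)
    (g := fun h => r h * ∑ k ∈ Finset.range (l + 1), a k *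
      (∑ i ∈ Finset.range k, (P h + h ^ (l + 1) * r h) ^ i * P h ^ (k - 1 - i)) +
      (Q h + h ^ l * r h) ^ (l + 1) * s (P h + h ^ (l + 1) * r h))
    (hφf.fun_sub hT) (AnalyticAt.fun_add (by fun_prop) (AnalyticAt.fun_mul (by fun_prop) hsU)) ?_
    (Nat.lt_succ_self l)
  filter_upwards [hU, hU0.eventually hφs] with h h1 h2
  rw [h1, h2]
  have h3 : ∀ k, (P h + h ^ (l + 1) * r h) ^ k = P h ^ k + h ^ (l + 1) * r h *
      ∑ i ∈ Finset.range k, (P h + h ^ (l + 1) * r h) ^ i * P h ^ (k - 1 - i) := by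
    intro k
    have := (Commute.all (P h + h ^ (l + 1) * r h) (P h)).geom_sum₂_mul k
    rw [add_sub_cancel_left] at this
    linear_combination -this
  have h4 : (P h + h ^ (l + 1) * r h) ^ (l + 1) = h ^ (l + 1) * (Q h + h ^ l * r h) ^ (l + 1) := by
    rw [← mul_pow, hPQ]; ring
  rw [h4, Finset.sum_congr rfl fun k _ => by rw [h3 k]]
  simp only [ha, mul_add, Finset.sum_add_distrib, Finset.mul_sum]
  simp only [add_sub_cancel_left, add_assoc, mul_assoc, mul_left_comm]

/-- **Faà di Bruno's formula** for analytic functions of one real variable. -/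
theorem iteratedDeriv_comp_eq_sum_tuples {φ f : ℝ → ℝ} {x : ℝ} (hf : AnalyticAt ℝ f x)
    (hφ : AnalyticAt ℝ φ (f x)) (l : ℕ) :
    iteratedDeriv l (fun y => φ (f y)) x = ∑ k ∈ tuples l,
      coeffL l k * iteratedDeriv (∑ j : Fin l, k j) φ (f x) *
        ∏ j : Fin l, iteratedDeriv ((j : ℕ) + 1) f x ^ k j := by
  rw [iteratedDeriv_comp_eq_iteratedDeriv_taylor hf hφ l]
  set y : Fin l → ℝ := fun j => iteratedDeriv ((j : ℕ) + 1) f x / (((j : ℕ) + 1).factorial : ℝ)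
    with hy
  have e : (fun h : ℝ => ∑ k ∈ Finset.range (l + 1), iteratedDeriv k φ (f x) / k.factorial *
      (∑ j : Fin l, y j * h ^ ((j : ℕ) + 1)) ^ k) = fun h : ℝ => ∑ k ∈ Finset.range (l + 1),
      ∑ κ ∈ Finset.piAntidiag Finset.univ k, iteratedDeriv k φ (f x) / k.factorial *
        (Nat.multinomial Finset.univ κ * ∏ j, y j ^ κ j) * h ^ (∑ j : Fin l, ((j : ℕ) + 1) * κ j) := by
    funext h
    refine Finset.sum_congr rfl fun k _ => ?_
    rw [Finset.sum_pow_eq_sum_piAntidiag, Finset.mul_sum]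
    refine Finset.sum_congr rfl fun κ _ => ?_
    simp only [mul_pow, Finset.prod_mul_distrib, ← pow_mul, Finset.prod_pow_eq_pow_sum]
    ring
  have hmaps : ∀ κ ∈ tuples l, ∑ j, κ j ∈ Finset.range (l + 1) := by
    intro κ hκ
    rw [mem_tuples] at hκ
    have : ∑ j, κ j ≤ ∑ j : Fin l, ((j : ℕ) + 1) * κ j :=
      Finset.sum_le_sum fun j _ => Nat.le_mul_of_pos_left _ (Nat.succ_pos _)
    rw [Finset.mem_range]; omega
  -- At `0` the `l`-th derivative keeps exactly the monomials of weight `l`, that is `tuples l`,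
  -- here grouped by the degree `k`.
  rw [e, iteratedDeriv_fun_sum (fun k _ => by fun_prop), ← Finset.sum_fiberwise_of_maps_to hmaps]
  refine Finset.sum_congr rfl fun k _ => ?_
  rw [iteratedDeriv_fun_sum (fun κ _ => by fun_prop)]
  have hset : (tuples l).filter (fun κ => ∑ j, κ j = k) =
      (Finset.piAntidiag Finset.univ k).filter
        fun κ : Fin l → ℕ => l = ∑ j : Fin l, ((j : ℕ) + 1) * κ j := by
    ext κ
    simp [mem_tuples, Finset.mem_piAntidiag, and_comm, eq_comm]
  rw [hset, Finset.sum_filter]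
  refine Finset.sum_congr rfl fun κ hκ => ?_
  rw [iteratedDeriv_const_mul_field, iteratedDeriv_fun_pow_zero]
  split_ifs with hl
  · have hk : ∑ j, κ j = k := by simpa [Finset.mem_piAntidiag] using hκ
    have hm : (∏ j, ((κ j).factorial : ℝ)) * (Nat.multinomial Finset.univ κ : ℝ) =
        (k.factorial : ℝ) := by
      have := Nat.multinomial_spec (s := Finset.univ) (f := κ)
      rw [hk] at this
      exact_mod_cast this
    have hne : (∏ j, ((κ j).factorial : ℝ)) ≠ 0 :=
      Finset.prod_ne_zero_iff.2 fun j _ => by positivity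
    have hne' : (∏ j : Fin l, (((j : ℕ) + 1).factorial : ℝ) ^ κ j) ≠ 0 :=
      Finset.prod_ne_zero_iff.2 fun j _ => by positivity
    have hkf : (k.factorial : ℝ) ≠ 0 := by positivity
    rw [← hl, hk, coeffL, Finset.prod_mul_distrib]
    simp only [hy, div_pow, Finset.prod_div_distrib]
    field_simp
    rw [← hm]
    ring
  · simp

/-! ### The shift on words -/

/-- The word `i w`. -/
def consWord (i : Fin 2) (w : ℕ → Fin 2) : ℕ → Fin 2
  | 0 => i
  | n + 1 => w n

@[simp] theorem consWord_zero (i : Fin 2) (w : ℕ → Fin 2) : consWord i w 0 = i := rfl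

@[simp] theorem consWord_succ (i : Fin 2) (w : ℕ → Fin 2) (n : ℕ) :
    consWord i w (n + 1) = w n := rfl

theorem measurable_consWord (i : Fin 2) : Measurable (consWord i) := by
  refine measurable_pi_iff.2 fun n => ?_
  cases n with
  | zero => exact measurable_const
  | succ n => exact measurable_pi_apply n

instance : IsProbabilityMeasure bernoulli := by
  unfold bernoulli; infer_instance

theorem uniform_eq_sum_dirac :
    (PMF.uniformOfFintype (Fin 2)).toMeasure =
      ∑ i : Fin 2, (2⁻¹ : ENNReal) • Measure.dirac i := by
  refine Measure.ext_of_singleton fun i => ?_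
  rw [PMF.toMeasure_apply_singleton _ _ (measurableSet_singleton i)]
  fin_cases i <;> simp

/-- Self-similarity of the Bernoulli measure: the first letter is independent of the remaining ones.
A product measure is determined by its values on cylinders, so it suffices to compare these. -/
theorem bernoulli_eq_sum_map_consWord :
    bernoulli = ∑ i : Fin 2, (2⁻¹ : ENNReal) • bernoulli.map (consWord i) := by
  symm
  refine Measure.eq_infinitePi _ fun s t ht => ?_
  classical
  -- The cylinder is rewritten over an initial segment containing index `0`, with full sets at the
  -- added coordinates, so that the first letter splits off.
  obtain ⟨M, hM⟩ : ∃ M, s ⊆ Finset.range (M + 1) :=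
    ⟨s.sup id, fun n hn => Finset.mem_range.2 (Nat.lt_succ_of_le (Finset.le_sup (f := id) hn))⟩
  set t' : ℕ → Set (Fin 2) := fun n => if n ∈ s then t n else Set.univ with ht'
  have hset : Set.pi (s : Set ℕ) t = Set.pi (Finset.range (M + 1) : Set ℕ) t' := by
    ext w
    simp only [Set.mem_pi, ht', Finset.mem_coe]
    constructor
    · intro h n _
      split_ifs with hn
      · exact h n hn
      · trivial
    · intro h n hn
      simpa [hn] using h n (hM hn)
  have hprod : ∏ n ∈ s, (PMF.uniformOfFintype (Fin 2)).toMeasure (t n) =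
      ∏ n ∈ Finset.range (M + 1), (PMF.uniformOfFintype (Fin 2)).toMeasure (t' n) := by
    rw [← Finset.prod_subset hM (fun n _ hn => by simp [ht', hn])]
    exact Finset.prod_congr rfl fun n hn => by simp [ht', hn]
  rw [hset, hprod, Finset.prod_range_succ']
  have hpre : ∀ i, bernoulli.map (consWord i) (Set.pi (Finset.range (M + 1) : Set ℕ) t') =
      (∏ n ∈ Finset.range M, (PMF.uniformOfFintype (Fin 2)).toMeasure (t' (n + 1))) *
        Measure.dirac i (t' 0) := by
    intro i
    rw [Measure.map_apply (measurable_consWord i)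
      (MeasurableSet.pi (Set.to_countable _) fun n _ => Set.Finite.measurableSet (Set.toFinite _))]
    have hpi : consWord i ⁻¹' Set.pi (Finset.range (M + 1) : Set ℕ) t' =
        {w | i ∈ t' 0} ∩ Set.pi (Finset.range M : Set ℕ) (fun n => t' (n + 1)) := by
      ext w
      simp only [Set.mem_preimage, Set.mem_pi, Finset.coe_range, Set.mem_Iio, Set.mem_inter_iff,
        Set.mem_ofPred_eq]
      constructor
      · intro h
        exact ⟨h 0 (Nat.succ_pos _), fun n hn => h (n + 1) (Nat.succ_lt_succ hn)⟩
      · rintro ⟨h0, h⟩ n hn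
        cases n with
        | zero => exact h0
        | succ n => exact h n (Nat.lt_of_succ_lt_succ hn)
    rw [hpi, Measure.dirac_apply]
    by_cases hi : i ∈ t' 0
    · simp only [hi, Set.ofPred_true, Set.univ_inter, Set.indicator_of_mem, Pi.one_apply, mul_one]
      exact Measure.infinitePi_pi _ fun n _ => Set.Finite.measurableSet (Set.toFinite _)
    · simp [hi]
  simp only [Measure.coe_finsetSum, Finset.sum_apply, Measure.smul_apply, hpre, smul_eq_mul]
  rw [uniform_eq_sum_dirac]
  simp only [Measure.coe_finsetSum, Finset.sum_apply, Measure.smul_apply, smul_eq_mul,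
    Finset.mul_sum]
  exact Finset.sum_congr rfl fun i _ => by ring

theorem lintegral_bernoulli_eq_sum_consWord {F : (ℕ → Fin 2) → ENNReal} (hF : Measurable F) :
    ∫⁻ w, F w ∂bernoulli = ∑ i : Fin 2, 2⁻¹ * ∫⁻ w, F (consWord i w) ∂bernoulli := by
  conv_lhs => rw [bernoulli_eq_sum_map_consWord]
  rw [lintegral_finsetSum_measure]
  refine Finset.sum_congr rfl fun i _ => ?_
  rw [lintegral_smul_measure, lintegral_map hF (measurable_consWord i), smul_eq_mul]

/-! ### Weights -/

@[simp] theorem weight_zero (lam : Fin 2 → ℝ) (w : ℕ → Fin 2) : weight lam w 0 = 1 := by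
  simp [weight]

theorem weight_consWord_succ (lam : Fin 2 → ℝ) (i : Fin 2) (w : ℕ → Fin 2) (m : ℕ) :
    weight lam (consWord i w) (m + 1) = lam i * weight lam w m := by
  rw [weight, Finset.prod_range_succ', mul_comm]
  rfl

theorem weight_pos {lam : Fin 2 → ℝ} (hlam : ∀ i, 0 < lam i) (w : ℕ → Fin 2) (m : ℕ) :
    0 < weight lam w m :=
  Finset.prod_pos fun _ _ => hlam _

theorem measurable_weight (lam : Fin 2 → ℝ) (m : ℕ) : Measurable fun w => weight lam w m := by
  unfold weight
  exact Finset.measurable_fun_prod _ fun k _ => (measurable_of_finite lam).comp (measurable_pi_apply k)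

theorem measurable_tsum_of_nonneg {α : Type*} [MeasurableSpace α] {f : ℕ → α → ℝ}
    (hf : ∀ m, Measurable (f m)) (h0 : ∀ m x, 0 ≤ f m x) : Measurable fun x => ∑' m, f m x := by
  -- No summability is needed: where the series diverges, both sides take the default value `0`.
  have : (fun x => ∑' m, f m x) = fun x => (∑' m, ENNReal.ofReal (f m x)).toReal := by
    funext x
    rw [ENNReal.tsum_toReal_eq fun _ => ENNReal.ofReal_ne_top]
    exact tsum_congr fun m => (ENNReal.toReal_ofReal (h0 m x)).symm
  rw [this]
  exact (Measurable.tsum fun m => (hf m).ennreal_ofReal).ennreal_toReal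

theorem measurable_X {lam : Fin 2 → ℝ} (hlam : ∀ i, 0 < lam i) : Measurable (X lam) :=
  measurable_tsum_of_nonneg (measurable_weight lam) fun m w => (weight_pos hlam w m).le

theorem one_le_X {lam : Fin 2 → ℝ} (hlam : ∀ i, 0 < lam i) {w : ℕ → Fin 2}
    (hw : Summable (weight lam w)) : 1 ≤ X lam w := by
  simpa [X] using hw.le_tsum 0 fun m _ => (weight_pos hlam w m).le

theorem X_consWord (lam : Fin 2 → ℝ) (i : Fin 2) {w : ℕ → Fin 2}
    (hw : Summable (weight lam w)) : X lam (consWord i w) = lam i * X lam w + 1 := by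
  have h : Summable fun m => weight lam (consWord i w) (m + 1) := by
    simpa only [weight_consWord_succ] using hw.mul_left (lam i)
  rw [X, ((summable_nat_add_iff 1).1 h).tsum_eq_zero_add]
  simp only [weight_consWord_succ, tsum_mul_left, weight_zero]
  rw [X, add_comm]

/-! ### Moments -/

theorem lintegral_weight_rpow {lam : Fin 2 → ℝ} (hlam : ∀ i, 0 < lam i) (s : ℝ) (m : ℕ) :
    ∫⁻ w, ENNReal.ofReal (weight lam w m ^ s) ∂bernoulli =
      ENNReal.ofReal ((lam 0 ^ s + lam 1 ^ s) / 2) ^ m := by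
  induction m with
  | zero => simp
  | succ m ih =>
    rw [lintegral_bernoulli_eq_sum_consWord
      ((measurable_weight lam (m + 1)).pow_const s).ennreal_ofReal]
    have h : ∀ i, ∫⁻ w, ENNReal.ofReal (weight lam (consWord i w) (m + 1) ^ s) ∂bernoulli =
        ENNReal.ofReal (lam i ^ s) * ENNReal.ofReal ((lam 0 ^ s + lam 1 ^ s) / 2) ^ m := by
      intro i
      rw [← ih, ← lintegral_const_mul _ ((measurable_weight lam m).pow_const s).ennreal_ofReal]
      refine lintegral_congr fun w => ?_
      rw [weight_consWord_succ, Real.mul_rpow (hlam i).le (weight_pos hlam w m).le,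
        ENNReal.ofReal_mul (Real.rpow_nonneg (hlam i).le s)]
    simp only [h, Fin.sum_univ_two]
    have h0 := Real.rpow_nonneg (hlam 0).le s
    have h1 := Real.rpow_nonneg (hlam 1).le s
    rw [pow_succ, div_eq_mul_inv, ENNReal.ofReal_mul (add_nonneg h0 h1), ENNReal.ofReal_add h0 h1,
      ENNReal.ofReal_inv_of_pos (by norm_num), ENNReal.ofReal_ofNat]
    ring

/-- With `q < p < 1` and `θ = p ^ (1/s)`, independence of the letters makes the expected terms
`(q/p) ^ m`. This one integrable quantity controls `X ^ s` for `s < 1` and `s ≥ 1` alike. -/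
theorem exists_lintegral_tsum_lt_top {lam : Fin 2 → ℝ} (hlam : ∀ i, 0 < lam i) {s : ℝ}
    (hs : 0 < s) (hq : (lam 0 ^ s + lam 1 ^ s) / 2 < 1) :
    ∃ θ : ℝ, 0 < θ ∧ θ < 1 ∧
      ∫⁻ w, ∑' m, ENNReal.ofReal ((weight lam w m / θ ^ m) ^ s) ∂bernoulli < ⊤ := by
  have h0 := Real.rpow_pos_of_pos (hlam 0) s
  have h1 := Real.rpow_pos_of_pos (hlam 1) s
  obtain ⟨p, hqp, hp1⟩ := exists_between hq
  set q := (lam 0 ^ s + lam 1 ^ s) / 2 with hqdef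
  have hq0 : 0 < q := by positivity
  have hp0 : 0 < p := hq0.trans hqp
  refine ⟨p ^ s⁻¹, Real.rpow_pos_of_pos hp0 _, Real.rpow_lt_one hp0.le hp1 (inv_pos.2 hs), ?_⟩
  have hmeas : ∀ m, Measurable fun w => ENNReal.ofReal ((weight lam w m / (p ^ s⁻¹) ^ m) ^ s) :=
    fun m => (((measurable_weight lam m).div_const _).pow_const s).ennreal_ofReal
  rw [lintegral_tsum fun m => (hmeas m).aemeasurable]
  have hm : ∀ m, ∫⁻ w, ENNReal.ofReal ((weight lam w m / (p ^ s⁻¹) ^ m) ^ s) ∂bernoulli =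
      ENNReal.ofReal (q / p) ^ m := by
    intro m
    have : ∀ w, ENNReal.ofReal ((weight lam w m / (p ^ s⁻¹) ^ m) ^ s) =
        ENNReal.ofReal (weight lam w m ^ s) * ENNReal.ofReal ((p ^ m)⁻¹) := by
      intro w
      have e : ((p ^ s⁻¹) ^ m) ^ s = p ^ m := by
        rw [← Real.rpow_natCast, ← Real.rpow_mul hp0.le, ← Real.rpow_mul hp0.le,
          ← Real.rpow_natCast]
        congr 1
        field_simp
      rw [Real.div_rpow (weight_pos hlam w m).le (by positivity), e, div_eq_mul_inv,
        ENNReal.ofReal_mul (Real.rpow_nonneg (weight_pos hlam w m).le s)]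
    simp only [this]
    rw [lintegral_mul_const _ ((measurable_weight lam m).pow_const s).ennreal_ofReal,
      lintegral_weight_rpow hlam, ← hqdef, ← ENNReal.ofReal_pow hq0.le,
      ← ENNReal.ofReal_mul (by positivity), ← ENNReal.ofReal_pow (by positivity), div_pow q p,
      div_eq_mul_inv (q ^ m)]
  simp only [hm]
  have hlt : q / p < 1 := (div_lt_one hp0).2 hqp
  simp only [← ENNReal.ofReal_pow (show 0 ≤ q / p by positivity)]
  rw [← ENNReal.ofReal_tsum_of_nonneg (fun m => by positivity)
    (summable_geometric_of_lt_one (by positivity) hlt)]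
  exact ENNReal.ofReal_lt_top

/-- Each term of the series is at most its sum `S`, so the weights are dominated by the geometric
sequence `S ^ (1/s) * θ ^ m`. -/
theorem summable_weight_and_X_rpow_le {lam : Fin 2 → ℝ} (hlam : ∀ i, 0 < lam i) {s θ : ℝ}
    (hs : 0 < s) (hθ : 0 < θ) (hθ1 : θ < 1) {w : ℕ → Fin 2}
    (hw : ∑' m, ENNReal.ofReal ((weight lam w m / θ ^ m) ^ s) < ⊤) :
    Summable (weight lam w) ∧ ENNReal.ofReal (X lam w ^ s) ≤
      ENNReal.ofReal ((1 - θ)⁻¹ ^ s) * ∑' m, ENNReal.ofReal ((weight lam w m / θ ^ m) ^ s) := by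
  set S := ∑' m, ENNReal.ofReal ((weight lam w m / θ ^ m) ^ s) with hS
  have hd : ∀ m, 0 < weight lam w m / θ ^ m := fun m => div_pos (weight_pos hlam w m) (by positivity)
  have hT0 : 0 ≤ S.toReal := ENNReal.toReal_nonneg
  have hle : ∀ m, weight lam w m ≤ S.toReal ^ s⁻¹ * θ ^ m := by
    intro m
    have h1 : (weight lam w m / θ ^ m) ^ s ≤ S.toReal := by
      rw [← ENNReal.ofReal_le_iff_le_toReal hw.ne]
      exact ENNReal.le_tsum m
    rw [← div_le_iff₀ (by positivity)]
    calc weight lam w m / θ ^ m = ((weight lam w m / θ ^ m) ^ s) ^ s⁻¹ := by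
          rw [← Real.rpow_mul (hd m).le, mul_inv_cancel₀ hs.ne', Real.rpow_one]
      _ ≤ _ := Real.rpow_le_rpow (Real.rpow_nonneg (hd m).le s) h1 (inv_nonneg.2 hs.le)
  have hgeo := (summable_geometric_of_lt_one hθ.le hθ1).mul_left (S.toReal ^ s⁻¹)
  have hsum : Summable (weight lam w) :=
    Summable.of_nonneg_of_le (fun m => (weight_pos hlam w m).le) hle hgeo
  refine ⟨hsum, ?_⟩
  have hX : X lam w ≤ S.toReal ^ s⁻¹ * (1 - θ)⁻¹ := by
    refine (hsum.tsum_le_tsum hle hgeo).trans_eq ?_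
    rw [tsum_mul_left, tsum_geometric_of_lt_one hθ.le hθ1]
  have h1θ : 0 < (1 - θ)⁻¹ := inv_pos.2 (by linarith)
  have hXs : X lam w ^ s ≤ (1 - θ)⁻¹ ^ s * S.toReal := by
    refine (Real.rpow_le_rpow (zero_le_one.trans (one_le_X hlam hsum)) hX hs.le).trans_eq ?_
    rw [Real.mul_rpow (Real.rpow_nonneg hT0 _) h1θ.le, ← Real.rpow_mul hT0,
      inv_mul_cancel₀ hs.ne', Real.rpow_one, mul_comm]
  refine (ENNReal.ofReal_le_ofReal hXs).trans_eq ?_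
  rw [ENNReal.ofReal_mul (Real.rpow_nonneg h1θ.le s), ENNReal.ofReal_toReal hw.ne]

theorem ae_summable_weight_and_integrable_X_rpow {lam : Fin 2 → ℝ} (hlam : ∀ i, 0 < lam i) {s : ℝ}
    (hs : 0 < s) (hq : (lam 0 ^ s + lam 1 ^ s) / 2 < 1) :
    (∀ᵐ w ∂bernoulli, Summable (weight lam w)) ∧
      Integrable (fun w => X lam w ^ s) bernoulli := by
  obtain ⟨θ, hθ, hθ1, hfin⟩ := exists_lintegral_tsum_lt_top hlam hs hq
  have hmeas : Measurable fun w => ∑' m, ENNReal.ofReal ((weight lam w m / θ ^ m) ^ s) :=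
    Measurable.tsum fun m => (((measurable_weight lam m).div_const _).pow_const s).ennreal_ofReal
  have hae := ae_lt_top hmeas hfin.ne
  refine ⟨hae.mono fun w hw => (summable_weight_and_X_rpow_le hlam hs hθ hθ1 hw).1,
    ((measurable_X hlam).pow_const s).aestronglyMeasurable, ?_⟩
  have h0 : ∀ w, 0 ≤ X lam w ^ s := fun w =>
    Real.rpow_nonneg (tsum_nonneg fun m => (weight_pos hlam w m).le) s
  rw [hasFiniteIntegral_iff_ofReal (Eventually.of_forall h0)]
  calc ∫⁻ w, ENNReal.ofReal (X lam w ^ s) ∂bernoulli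
      ≤ ∫⁻ w, ENNReal.ofReal ((1 - θ)⁻¹ ^ s) *
          ∑' m, ENNReal.ofReal ((weight lam w m / θ ^ m) ^ s) ∂bernoulli :=
        lintegral_mono_ae (hae.mono fun w hw =>
          (summable_weight_and_X_rpow_le hlam hs hθ hθ1 hw).2)
    _ < ⊤ := by
        rw [lintegral_const_mul _ hmeas]
        exact ENNReal.mul_lt_top ENNReal.ofReal_lt_top hfin

/-- At `s = 0` the function `a ^ s + b ^ s` equals `2` and has derivative `log (a * b) < 0`. -/
theorem exists_pos_rpow_add_rpow_lt {a b : ℝ} (ha : 0 < a) (hb : 0 < b) (hab : a * b < 1) :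
    ∃ s : ℝ, 0 < s ∧ (a ^ s + b ^ s) / 2 < 1 := by
  have hd : HasDerivAt (fun s : ℝ => a ^ s + b ^ s) (Real.log (a * b)) 0 := by
    have := ((Real.hasStrictDerivAt_const_rpow ha 0).hasDerivAt).fun_add
      ((Real.hasStrictDerivAt_const_rpow hb 0).hasDerivAt)
    rw [Real.log_mul ha.ne' hb.ne']
    simpa using this
  have hneg : Real.log (a * b) < 0 := Real.log_neg (by positivity) hab
  have h1 : ∀ᶠ s in 𝓝[>] (0 : ℝ), slope (fun s : ℝ => a ^ s + b ^ s) 0 s < 0 :=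
    ((hasDerivAt_iff_tendsto_slope.1 hd).mono_left
      (nhdsWithin_mono _ fun x hx => (Set.mem_Ioi.1 hx).ne')).eventually_lt_const hneg
  obtain ⟨s, hs, hs0⟩ := (h1.and self_mem_nhdsWithin).exists
  have hs0' : 0 < s := hs0
  refine ⟨s, hs0', ?_⟩
  rw [slope_def_field, div_neg_iff] at hs
  simp only [Real.rpow_zero, sub_zero] at hs
  rcases hs with h | h <;> linarith [h.1, h.2]

theorem ae_summable_weight {lam : Fin 2 → ℝ} (hlam : ∀ i, 0 < lam i) (h : lam 0 * lam 1 < 1) :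
    ∀ᵐ w ∂bernoulli, Summable (weight lam w) := by
  obtain ⟨s, hs, hq⟩ := exists_pos_rpow_add_rpow_lt (hlam 0) (hlam 1) h
  exact (ae_summable_weight_and_integrable_X_rpow hlam hs hq).1

/-! ### The stationary measure -/

theorem isStationary_map_X {lam : Fin 2 → ℝ} (hlam : ∀ i, 0 < lam i) (h : lam 0 * lam 1 < 1) :
    IsStationary lam (bernoulli.map (X lam)) := by
  have hX := measurable_X hlam
  refine ⟨Measure.isProbabilityMeasure_map hX.aemeasurable, ?_⟩
  have hi : ∀ i, (bernoulli.map (X lam)).map (fun x => lam i * x + 1) =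
      (bernoulli.map (consWord i)).map (X lam) := by
    intro i
    rw [Measure.map_map (by fun_prop) hX, Measure.map_map hX (measurable_consWord i)]
    refine Measure.map_congr ?_
    filter_upwards [ae_summable_weight hlam h] with w hw
    exact (X_consWord lam i hw).symm
  conv_lhs => rw [bernoulli_eq_sum_map_consWord]
  simp only [Fin.sum_univ_two, hi]
  rw [Measure.map_add _ _ hX, Measure.map_smul, Measure.map_smul]

/-- Stationarity iterated `n` times; each new letter is prepended as the outermost map, so the
composed maps converge pointwise along almost every word in the contracting case. -/
theorem IsStationary.lintegral_eq {lam : Fin 2 → ℝ} {μ : Measure ℝ} (hμ : IsStationary lam μ)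
    (n : ℕ) {g : ℝ → ENNReal} (hg : Measurable g) :
    ∫⁻ x, g x ∂μ = ∫⁻ y, ∫⁻ w, g (∑ m ∈ Finset.range n, weight lam w m + weight lam w n * y)
      ∂bernoulli ∂μ := by
  have hstep : ∀ {g : ℝ → ENNReal}, Measurable g →
      ∫⁻ x, g x ∂μ = ∑ i : Fin 2, 2⁻¹ * ∫⁻ x, g (lam i * x + 1) ∂μ := by
    intro g hg
    conv_lhs => rw [hμ.2]
    rw [lintegral_finsetSum_measure]
    refine Finset.sum_congr rfl fun i _ => ?_
    rw [lintegral_smul_measure, lintegral_map hg (by fun_prop), smul_eq_mul]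
  have hmeas : ∀ n, Measurable fun p : ℝ × (ℕ → Fin 2) =>
      ∑ m ∈ Finset.range n, weight lam p.2 m + weight lam p.2 n * p.1 := fun n =>
    (Finset.measurable_fun_sum _ fun m _ => (measurable_weight lam m).comp measurable_snd).add
      (((measurable_weight lam n).comp measurable_snd).mul measurable_fst)
  induction n generalizing g with
  | zero => simp
  | succ n ih =>
    rw [hstep hg]
    have h1 : ∀ y, ∫⁻ w, g (∑ m ∈ Finset.range (n + 1), weight lam w m + weight lam w (n + 1) * y)
        ∂bernoulli = ∑ i : Fin 2, 2⁻¹ * ∫⁻ w, g (lam i * (∑ m ∈ Finset.range n, weight lam w m +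
          weight lam w n * y) + 1) ∂bernoulli := by
      intro y
      rw [lintegral_bernoulli_eq_sum_consWord (F := fun w => g (∑ m ∈ Finset.range (n + 1),
        weight lam w m + weight lam w (n + 1) * y))
        (hg.comp ((hmeas (n + 1)).comp measurable_prodMk_left))]
      refine Finset.sum_congr rfl fun i _ => ?_
      congr 1
      refine lintegral_congr fun w => ?_
      congr 1
      rw [Finset.sum_range_succ']
      simp only [weight_consWord_succ, weight_zero, ← Finset.mul_sum]
      ring
    have h2 : ∀ i : Fin 2, Measurable fun y => ∫⁻ w, g (lam i * (∑ m ∈ Finset.range n,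
        weight lam w m + weight lam w n * y) + 1) ∂bernoulli := fun i =>
      Measurable.lintegral_prod_right' (f := fun p : ℝ × (ℕ → Fin 2) => g (lam i *
        (∑ m ∈ Finset.range n, weight lam p.2 m + weight lam p.2 n * p.1) + 1))
        (hg.comp (((hmeas n).const_mul _).add_const 1))
    simp only [h1]
    rw [lintegral_finsetSum _ fun i _ => (h2 i).const_mul _]
    refine Finset.sum_congr rfl fun i _ => ?_
    rw [lintegral_const_mul _ (h2 i), ih (g := fun x => g (lam i * x + 1)) (hg.comp (by fun_prop))]

/-- Since `weight lam w n` tends to `0` almost surely, the starting point `y` is forgotten in the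
limit. Dominated convergence, in `w` and then in `y`, applies to bounded continuous test functions.
-/
theorem IsStationary.eq_map_X {lam : Fin 2 → ℝ} (hlam : ∀ i, 0 < lam i) (h : lam 0 * lam 1 < 1)
    {μ : Measure ℝ} (hμ : IsStationary lam μ) : μ = bernoulli.map (X lam) := by
  have hX := measurable_X hlam
  have := hμ.1
  have : IsProbabilityMeasure (bernoulli.map (X lam)) :=
    Measure.isProbabilityMeasure_map hX.aemeasurable
  refine ext_of_forall_lintegral_eq_of_IsFiniteMeasure fun f => ?_
  have hf : Measurable fun x => (f x : ENNReal) := f.continuous.measurable.coe_nnreal_ennreal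
  have hbd : ∀ x, (f x : ENNReal) ≤ (nndist f 0 : NNReal) := fun x =>
    ENNReal.coe_le_coe.2 (BoundedContinuousFunction.NNReal.upper_bound f x)
  have hmeas : ∀ n, Measurable fun p : ℝ × (ℕ → Fin 2) =>
      ∑ m ∈ Finset.range n, weight lam p.2 m + weight lam p.2 n * p.1 := fun n =>
    (Finset.measurable_fun_sum _ fun m _ => (measurable_weight lam m).comp measurable_snd).add
      (((measurable_weight lam n).comp measurable_snd).mul measurable_fst)
  have hin : ∀ y, Tendsto (fun n => ∫⁻ w, (f (∑ m ∈ Finset.range n, weight lam w m +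
      weight lam w n * y) : ENNReal) ∂bernoulli) atTop (𝓝 (∫⁻ w, f (X lam w) ∂bernoulli)) := by
    intro y
    refine tendsto_lintegral_of_dominated_convergence (fun _ => ((nndist f 0 : NNReal) : ENNReal))
      (fun n => hf.comp ((hmeas n).comp measurable_prodMk_left))
      (fun n => Eventually.of_forall fun w => hbd _) (by simp) ?_
    filter_upwards [ae_summable_weight hlam h] with w hw
    have ht : Tendsto (fun n => ∑ m ∈ Finset.range n, weight lam w m + weight lam w n * y) atTop
        (𝓝 (X lam w)) := by
      simpa [X] using hw.hasSum.tendsto_sum_nat.add (hw.tendsto_atTop_zero.mul_const y)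
    exact ENNReal.tendsto_coe.2 ((f.continuous.tendsto _).comp ht)
  have hout : Tendsto (fun n => ∫⁻ y, ∫⁻ w, (f (∑ m ∈ Finset.range n, weight lam w m +
      weight lam w n * y) : ENNReal) ∂bernoulli ∂μ) atTop
      (𝓝 (∫⁻ _, ∫⁻ w, f (X lam w) ∂bernoulli ∂μ)) := by
    refine tendsto_lintegral_of_dominated_convergence (fun _ => ((nndist f 0 : NNReal) : ENNReal))
      (fun n => Measurable.lintegral_prod_right' (f := fun p : ℝ × (ℕ → Fin 2) =>
        (f (∑ m ∈ Finset.range n, weight lam p.2 m + weight lam p.2 n * p.1) : ENNReal))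
        (hf.comp (hmeas n)))
      (fun n => Eventually.of_forall fun y => ?_) (by simp) (Eventually.of_forall fun y => hin y)
    exact (lintegral_mono fun w => hbd _).trans (by simp)
  rw [lintegral_map hf hX]
  refine tendsto_nhds_unique ?_ (by simpa using hout)
  simp only [← hμ.lintegral_eq _ hf]
  exact tendsto_const_nhds

theorem existsUnique_isStationary {lam : Fin 2 → ℝ} (hlam : ∀ i, 0 < lam i)
    (h : lam 0 * lam 1 < 1) : ∃! μ : Measure ℝ, IsStationary lam μ :=
  ⟨_, isStationary_map_X hlam h, fun _ hμ => hμ.eq_map_X hlam h⟩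

/-! ### Dependence of the projection on the first ratio -/

theorem pair_pos {c b : ℝ} (hc : 0 < c) (hb : 0 < b) : ∀ i : Fin 2, 0 < ![c, b] i := by
  intro i; fin_cases i <;> simpa

theorem weight_eq_pow_mul (c b : ℝ) (w : ℕ → Fin 2) (m : ℕ) :
    weight ![c, b] w m = c ^ firstCount w m * weight ![1, b] w m := by
  have h : ∀ k, ![c, b] (w k) = (if w k = 0 then c else 1) * ![1, b] (w k) := by
    intro k
    generalize w k = i
    fin_cases i <;> simp
  rw [weight, Finset.prod_congr rfl fun k _ => h k, Finset.prod_mul_distrib, Finset.prod_ite]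
  simp [firstCount, weight]

theorem weight_mono {c d b : ℝ} (hc : 0 < c) (hcd : c ≤ d) (hb : 0 < b) (w : ℕ → Fin 2) (m : ℕ) :
    weight ![c, b] w m ≤ weight ![d, b] w m := by
  have := weight_pos (pair_pos one_pos hb) w m
  rw [weight_eq_pow_mul c, weight_eq_pow_mul d]
  gcongr

theorem summable_weight_mono {c d b : ℝ} (hc : 0 < c) (hcd : c ≤ d) (hb : 0 < b) {w : ℕ → Fin 2}
    (h : Summable (weight ![d, b] w)) : Summable (weight ![c, b] w) :=
  Summable.of_nonneg_of_le (fun m => (weight_pos (pair_pos hc hb) w m).le)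
    (weight_mono hc hcd hb w) h

/-- Weights increase with the first ratio, so countably many rational ratios yield one null set
serving all `c`. -/
theorem ae_forall_summable_weight {b : ℝ} (hb : 0 < b) :
    ∀ᵐ w ∂bernoulli, ∀ c : ℝ, 0 < c → c * b < 1 → Summable (weight ![c, b] w) := by
  have h : ∀ᵐ w ∂bernoulli, ∀ q : ℚ, 0 < (q : ℝ) → (q : ℝ) * b < 1 →
      Summable (weight ![(q : ℝ), b] w) := by
    rw [ae_all_iff]
    intro q
    by_cases hq : 0 < (q : ℝ) ∧ (q : ℝ) * b < 1
    · filter_upwards [ae_summable_weight (pair_pos hq.1 hb) (by simpa using hq.2)] with w hw _ _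
      exact hw
    · exact Eventually.of_forall fun w h1 h2 => absurd ⟨h1, h2⟩ hq
  filter_upwards [h] with w hw c hc hcb
  obtain ⟨q, hcq, hqb⟩ := exists_rat_btwn ((lt_div_iff₀ hb).2 hcb)
  exact summable_weight_mono hc hcq.le hb (hw q (hc.trans hcq) ((lt_div_iff₀ hb).1 hqb))

theorem hasSum_weight_add {c : ℝ} (hc : 0 < c) (b h : ℝ) (w : ℕ → Fin 2) (m : ℕ) :
    HasSum (fun j : ℕ => h ^ j *
      (weight ![c, b] w m * ((firstCount w m).choose j : ℝ) / c ^ j)) (weight ![c + h, b] w m) := by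
  have e : weight ![c + h, b] w m = ∑ j ∈ Finset.range (firstCount w m + 1), h ^ j *
      (weight ![c, b] w m * ((firstCount w m).choose j : ℝ) / c ^ j) := by
    rw [weight_eq_pow_mul, weight_eq_pow_mul c, add_comm c h, add_pow, Finset.sum_mul]
    refine Finset.sum_congr rfl fun j hj => ?_
    have : c ^ firstCount w m = c ^ (firstCount w m - j) * c ^ j := by
      rw [← pow_add, Nat.sub_add_cancel (Nat.lt_succ_iff.1 (Finset.mem_range.1 hj))]
    rw [this]
    field_simp
  rw [e]
  refine hasSum_sum_of_ne_finset_zero fun j hj => ?_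
  rw [Nat.choose_eq_zero_of_lt (by simpa using hj)]
  simp

/-- The `j`-th Taylor coefficient of `X` in the first ratio. -/
noncomputable def XCoeff (b : ℝ) (w : ℕ → Fin 2) (c : ℝ) (j : ℕ) : ℝ :=
  ∑' m : ℕ, weight ![c, b] w m * ((firstCount w m).choose j : ℝ) / c ^ j

/-- All terms are nonnegative and, by the binomial theorem, the row sums are the weights for the
ratio `c + ρ`. This justifies exchanging the two sums in `hasSum_XCoeff`. -/
theorem summable_prod_weight {b c ρ : ℝ} (hb : 0 < b) (hc : 0 < c) (hρ : 0 ≤ ρ) {w : ℕ → Fin 2}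
    (hw : Summable (weight ![c + ρ, b] w)) :
    Summable fun p : ℕ × ℕ => ρ ^ p.2 *
      (weight ![c, b] w p.1 * ((firstCount w p.1).choose p.2 : ℝ) / c ^ p.2) := by
  rw [summable_prod_of_nonneg fun p => by
    have := weight_pos (pair_pos hc hb) w p.1
    simp only [Pi.zero_apply]
    positivity]
  refine ⟨fun m => (hasSum_weight_add hc b ρ w m).summable, ?_⟩
  simpa only [(hasSum_weight_add hc b ρ w _).tsum_eq] using hw

theorem summable_XCoeff_aux {b c ρ : ℝ} (hb : 0 < b) (hc : 0 < c) (hρ : 0 < ρ) {w : ℕ → Fin 2}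
    (hw : Summable (weight ![c + ρ, b] w)) (j : ℕ) :
    Summable fun m => weight ![c, b] w m * ((firstCount w m).choose j : ℝ) / c ^ j := by
  have h := (summable_prod_weight hb hc hρ.le hw).prod_symm.prod_factor j
  simp only [Prod.fst_swap, Prod.snd_swap] at h
  exact (summable_mul_left_iff (pow_pos hρ j).ne').1 h

theorem hasSum_XCoeff {b c h : ℝ} (hb : 0 < b) (hc : 0 < c) {w : ℕ → Fin 2}
    (hw : Summable (weight ![c + |h|, b] w)) :
    HasSum (fun j => h ^ j * XCoeff b w c j) (X ![c + h, b] w) := by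
  have hs : Summable fun p : ℕ × ℕ => h ^ p.2 *
      (weight ![c, b] w p.1 * ((firstCount w p.1).choose p.2 : ℝ) / c ^ p.2) := by
    refine Summable.of_norm ((summable_prod_weight hb hc (abs_nonneg h) hw).congr fun p => ?_)
    have := weight_pos (pair_pos hc hb) w p.1
    rw [norm_mul, norm_pow, Real.norm_eq_abs, Real.norm_of_nonneg (by positivity)]
  have h1 : HasSum (fun m => weight ![c + h, b] w m) (∑' p : ℕ × ℕ, h ^ p.2 *
      (weight ![c, b] w p.1 * ((firstCount w p.1).choose p.2 : ℝ) / c ^ p.2)) :=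
    hs.hasSum.prod_fiberwise fun m => hasSum_weight_add hc b h w m
  have h2 := hs.prod_symm.hasSum.prod_fiberwise fun j => (hs.prod_symm.prod_factor j).hasSum
  rw [X, h1.tsum_eq]
  simp only [Prod.fst_swap, Prod.snd_swap, tsum_mul_left] at h2
  rwa [← (Equiv.prodComm ℕ ℕ).tsum_eq]

theorem hasFPowerSeriesAt_X {b c ρ : ℝ} (hb : 0 < b) (hc : 0 < c) (hρ : 0 < ρ) {w : ℕ → Fin 2}
    (hw : Summable (weight ![c + ρ, b] w)) :
    HasFPowerSeriesAt (fun c => X ![c, b] w)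
      (FormalMultilinearSeries.ofScalars ℝ (XCoeff b w c)) c := by
  rw [hasFPowerSeriesAt_iff]
  filter_upwards [Metric.ball_mem_nhds 0 hρ] with h hh
  have hh' : |h| < ρ := by simpa using hh
  simp only [FormalMultilinearSeries.coeff_ofScalars, smul_eq_mul]
  exact hasSum_XCoeff hb hc
    (summable_weight_mono (by positivity) (by linarith) hb hw)

theorem iteratedDeriv_X {b c ρ : ℝ} (hb : 0 < b) (hc : 0 < c) (hρ : 0 < ρ) {w : ℕ → Fin 2}
    (hw : Summable (weight ![c + ρ, b] w)) (j : ℕ) :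
    iteratedDeriv j (fun c => X ![c, b] w) c = j.factorial * XCoeff b w c j := by
  have h := hasFPowerSeriesAt_X hb hc hρ hw
  have h' := congrArg (fun p => FormalMultilinearSeries.coeff p j)
    (h.analyticAt.hasFPowerSeriesAt.eq_formalMultilinearSeries h)
  simp only [FormalMultilinearSeries.coeff_ofScalars] at h'
  rw [← h']
  field_simp

theorem XDeriv_eq_factorial_mul_XCoeff {b c ρ : ℝ} (hb : 0 < b) (hc : 0 < c) (hρ : 0 < ρ)
    {w : ℕ → Fin 2} (hw : Summable (weight ![c + ρ, b] w)) {j : ℕ} (hj : 1 ≤ j) :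
    (Summable fun m => weight ![c, b] w (m + 1) * ((firstCount w (m + 1)).choose j : ℝ)) ∧
      XDeriv ![c, b] j w = j.factorial * XCoeff b w c j := by
  have hs := summable_XCoeff_aux hb hc hρ hw j
  -- The term `m = 0` vanishes because `j ≥ 1`, which reconciles the index shift in `XDeriv` with
  -- `XCoeff`.
  have h0 : (0 : ℕ).choose j = 0 := Nat.choose_eq_zero_of_lt hj
  have hs' := (summable_nat_add_iff 1).2 hs
  refine ⟨(summable_div_const_iff (pow_pos hc j).ne').1 hs', ?_⟩
  rw [XCoeff, hs.tsum_eq_zero_add, XDeriv]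
  simp only [weight_zero, firstCount, Finset.range_zero, Finset.filter_empty, Finset.card_empty, h0,
    tsum_div_const, Matrix.cons_val_zero]
  simp
  ring

theorem analyticAt_X {b c ρ : ℝ} (hb : 0 < b) (hc : 0 < c) (hρ : 0 < ρ) {w : ℕ → Fin 2}
    (hw : Summable (weight ![c + ρ, b] w)) : AnalyticAt ℝ (fun c => X ![c, b] w) c :=
  (hasFPowerSeriesAt_X hb hc hρ hw).analyticAt

theorem analyticAt_rpow_const {x : ℝ} (hx : x ≠ 0) (t : ℝ) : AnalyticAt ℝ (fun x : ℝ => x ^ t) x :=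
  ContDiffAt.analyticAt (Real.contDiffAt_rpow_const_of_ne hx)

theorem analyticAt_X_rpow {b c ρ : ℝ} (hb : 0 < b) (hc : 0 < c) (hρ : 0 < ρ) {w : ℕ → Fin 2}
    (hw : Summable (weight ![c + ρ, b] w)) (t : ℝ) :
    AnalyticAt ℝ (fun c => X ![c, b] w ^ t) c := by
  have h1 : 1 ≤ X ![c, b] w :=
    one_le_X (pair_pos hc hb) (summable_weight_mono hc (by linarith) hb hw)
  exact AnalyticAt.fun_comp (g := fun x : ℝ => x ^ t)
    (analyticAt_rpow_const (by linarith) t) (analyticAt_X hb hc hρ hw)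

theorem iteratedDeriv_X_rpow {b c ρ : ℝ} (hb : 0 < b) (hc : 0 < c) (hρ : 0 < ρ) {w : ℕ → Fin 2}
    (hw : Summable (weight ![c + ρ, b] w)) (t : ℝ) (l : ℕ) :
    iteratedDeriv l (fun c => X ![c, b] w ^ t) c =
      formalDeriv (fun x : ℝ => x ^ t) ![c, b] l w := by
  have h1 : 1 ≤ X ![c, b] w :=
    one_le_X (pair_pos hc hb) (summable_weight_mono hc (by linarith) hb hw)
  rw [iteratedDeriv_comp_eq_sum_tuples (φ := fun x : ℝ => x ^ t) (analyticAt_X hb hc hρ hw)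
    (analyticAt_rpow_const (by linarith) t), formalDeriv]
  refine Finset.sum_congr rfl fun k _ => ?_
  congr 1
  refine Finset.prod_congr rfl fun j _ => ?_
  rw [iteratedDeriv_X hb hc hρ hw,
    (XDeriv_eq_factorial_mul_XCoeff hb hc hρ hw (Nat.succ_pos j)).2]

/-! ### Bounds for the derivatives -/

theorem XDeriv_nonneg {b c : ℝ} (hb : 0 < b) (hc : 0 < c) (j : ℕ) (w : ℕ → Fin 2) :
    0 ≤ XDeriv ![c, b] j w := by
  refine mul_nonneg (by simpa using by positivity) (tsum_nonneg fun m => ?_)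
  exact mul_nonneg (weight_pos (pair_pos hc hb) w _).le (Nat.cast_nonneg _)

/-- A Cauchy-type estimate: a single term of a Taylor series with nonnegative terms is at most its
sum at `c + ρ`. -/
theorem XDeriv_le {b c ρ : ℝ} (hb : 0 < b) (hc : 0 < c) (hρ : 0 < ρ)
    {w : ℕ → Fin 2} (hw : Summable (weight ![c + ρ, b] w)) {j : ℕ} (hj : 1 ≤ j) :
    XDeriv ![c, b] j w ≤ j.factorial / ρ ^ j * X ![c + ρ, b] w := by
  have h := hasSum_XCoeff (h := ρ) hb hc (by rwa [abs_of_pos hρ])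
  have h0 : ∀ i, 0 ≤ XCoeff b w c i := fun i => tsum_nonneg fun m => by
    have := weight_pos (pair_pos hc hb) w m
    positivity
  have hle := le_hasSum h j fun i _ => mul_nonneg (by positivity) (h0 i)
  rw [(XDeriv_eq_factorial_mul_XCoeff hb hc hρ hw hj).2, div_mul_eq_mul_div, mul_div_assoc]
  gcongr
  rwa [le_div_iff₀ (by positivity), mul_comm]

/-- `X` is log-convex as a function of the logarithm of the first ratio. -/
theorem X_le_rpow_mul_rpow {b c c' d θ : ℝ} (hb : 0 < b) (hc : 0 < c) (hc' : 0 < c') (hd : 0 < d)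
    (hθ : 0 < θ) (hθ1 : θ < 1) (hdle : d ≤ c ^ (1 - θ) * c' ^ θ) {w : ℕ → Fin 2}
    (hw : Summable (weight ![c, b] w)) (hw' : Summable (weight ![c', b] w)) :
    X ![d, b] w ≤ X ![c, b] w ^ (1 - θ) * X ![c', b] w ^ θ := by
  have h1θ : 0 < 1 - θ := sub_pos.2 hθ1
  have hp := fun m => weight_pos (pair_pos hc hb) w m
  have hp' := fun m => weight_pos (pair_pos hc' hb) w m
  -- The power of the first ratio interpolates geometrically, while the contribution of the second
  -- letter is common to all three weights.
  have hle : ∀ m, weight ![d, b] w m ≤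
      weight ![c, b] w m ^ (1 - θ) * weight ![c', b] w m ^ θ := by
    intro m
    have hβ := weight_pos (pair_pos one_pos hb) w m
    rw [weight_eq_pow_mul d, weight_eq_pow_mul c, weight_eq_pow_mul c',
      Real.mul_rpow (by positivity) hβ.le, Real.mul_rpow (by positivity) hβ.le,
      mul_mul_mul_comm, ← Real.rpow_add hβ, sub_add_cancel, Real.rpow_one,
      ← Real.rpow_natCast c, ← Real.rpow_natCast c', ← Real.rpow_mul hc.le, ← Real.rpow_mul hc'.le,
      mul_comm _ (1 - θ), mul_comm _ θ, Real.rpow_mul hc.le, Real.rpow_mul hc'.le,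
      ← Real.mul_rpow (by positivity) (by positivity), Real.rpow_natCast]
    gcongr
  have hpq : (1 - θ)⁻¹.HolderConjugate θ⁻¹ :=
    Real.HolderConjugate.one_sub_inv_inv hθ hθ1
  have e : ∀ m, (weight ![c, b] w m ^ (1 - θ)) ^ (1 - θ)⁻¹ = weight ![c, b] w m := fun m => by
    rw [← Real.rpow_mul (hp m).le, mul_inv_cancel₀ h1θ.ne', Real.rpow_one]
  have e' : ∀ m, (weight ![c', b] w m ^ θ) ^ θ⁻¹ = weight ![c', b] w m := fun m => by
    rw [← Real.rpow_mul (hp' m).le, mul_inv_cancel₀ hθ.ne', Real.rpow_one]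
  have hH := Real.summable_and_inner_le_Lp_mul_Lq_tsum_of_nonneg hpq
    (f := fun m => weight ![c, b] w m ^ (1 - θ)) (g := fun m => weight ![c', b] w m ^ θ)
    (fun m => Real.rpow_nonneg (hp m).le _) (fun m => Real.rpow_nonneg (hp' m).le _)
    (by simpa only [e] using hw) (by simpa only [e'] using hw')
  simp only [e, e', one_div, inv_inv] at hH
  refine (Summable.tsum_le_tsum hle ?_ hH.1).trans hH.2
  exact Summable.of_nonneg_of_le (fun m => (weight_pos (pair_pos hd hb) w m).le) hle hH.1

theorem X_mono {b c d : ℝ} (hb : 0 < b) (hc : 0 < c) (hcd : c ≤ d) {w : ℕ → Fin 2}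
    (hw : Summable (weight ![d, b] w)) : X ![c, b] w ≤ X ![d, b] w :=
  (summable_weight_mono hc hcd hb hw).tsum_le_tsum (weight_mono hc hcd hb w) hw

theorem iteratedDeriv_rpow_const (t x : ℝ) (k : ℕ) :
    iteratedDeriv k (fun x : ℝ => x ^ t) x = (descPochhammer ℝ k).eval t * x ^ (t - k) := by
  rw [iteratedDeriv_eq_iterate, Real.iter_deriv_rpow_const]

/-- The `XDeriv` factors cost at most a constant times `y ^ k`, where `k ≤ l` counts them. Pairing
them with `x ^ (t - k)` gives `x ^ t * (y / x) ^ k`, and log-convexity bounds `y / x` by `z ^ θ`;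
the exponent thus grows by at most `θ * l`. -/
theorem exists_abs_formalDeriv_le {b t ρ θ : ℝ} (hb : 0 < b) (ht : 0 < t) (hρ : 0 < ρ) (hθ : 0 < θ)
    (hθ1 : θ < 1) (l : ℕ) :
    ∃ C : ℝ, ∀ (w : ℕ → Fin 2) (c c' : ℝ), 0 < c → c ≤ c' → c + ρ ≤ c ^ (1 - θ) * c' ^ θ →
      Summable (weight ![c', b] w) →
      |formalDeriv (fun x : ℝ => x ^ t) ![c, b] l w| ≤ C * X ![c', b] w ^ (t + θ * l) := by
  refine ⟨∑ k ∈ tuples l, |coeffL l k * (descPochhammer ℝ (∑ j, k j)).eval t| *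
    ∏ j : Fin l, ((((j : ℕ) + 1).factorial : ℝ) / ρ ^ ((j : ℕ) + 1)) ^ k j, ?_⟩
  intro w c c' hc hcc' hcρ hw'
  have hc' : 0 < c' := hc.trans_le hcc'
  have hρc' : c + ρ ≤ c' := by
    refine hcρ.trans ?_
    calc c ^ (1 - θ) * c' ^ θ ≤ c' ^ (1 - θ) * c' ^ θ := by gcongr
      _ = c' := by rw [← Real.rpow_add hc', sub_add_cancel, Real.rpow_one]
  have hw := summable_weight_mono hc hcc' hb hw'
  have hwρ := summable_weight_mono (by positivity) hρc' hb hw'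
  set x := X ![c, b] w with hx
  set y := X ![c + ρ, b] w with hy
  set z := X ![c', b] w with hz
  have hy1 : 1 ≤ y := one_le_X (pair_pos (by positivity) hb) hwρ
  have hx1 : 1 ≤ x := one_le_X (pair_pos hc hb) hw
  have hz1 : 1 ≤ z := one_le_X (pair_pos hc' hb) hw'
  have hxz : x ≤ z := X_mono hb hc hcc' hw'
  have hx0 : 0 < x := by linarith
  have hz0 : 0 < z := by linarith
  have hyx : y / x ≤ z ^ θ := by
    rw [div_le_iff₀ hx0]
    refine (X_le_rpow_mul_rpow hb hc hc' (by positivity) hθ hθ1 hcρ hw hw').trans ?_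
    rw [mul_comm]
    gcongr
    calc x ^ (1 - θ) ≤ x ^ (1 : ℝ) := Real.rpow_le_rpow_of_exponent_le hx1 (by linarith)
      _ = x := Real.rpow_one x
  rw [formalDeriv, Finset.sum_mul]
  refine (Finset.abs_sum_le_sum_abs _ _).trans (Finset.sum_le_sum fun k hk => ?_)
  have hkl : ∑ j, k j ≤ l := by
    rw [mem_tuples] at hk
    calc ∑ j, k j ≤ ∑ j : Fin l, ((j : ℕ) + 1) * k j :=
          Finset.sum_le_sum fun j _ => Nat.le_mul_of_pos_left _ (Nat.succ_pos _)
      _ = l := hk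
  have hprod : ∏ j : Fin l, XDeriv ![c, b] ((j : ℕ) + 1) w ^ k j ≤
      (∏ j : Fin l, ((((j : ℕ) + 1).factorial : ℝ) / ρ ^ ((j : ℕ) + 1)) ^ k j) *
        y ^ (∑ j, k j) := by
    rw [← Finset.prod_pow_eq_pow_sum, ← Finset.prod_mul_distrib]
    refine Finset.prod_le_prod (fun j _ => pow_nonneg (XDeriv_nonneg hb hc _ w) _) fun j _ => ?_
    rw [← mul_pow]
    exact pow_le_pow_left₀ (XDeriv_nonneg hb hc _ w)
      (XDeriv_le hb hc hρ hwρ (Nat.succ_pos j)) _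
  have hxy : x ^ (t - (∑ j, k j : ℕ)) * y ^ (∑ j, k j) ≤ z ^ (t + θ * l) := by
    calc x ^ (t - (∑ j, k j : ℕ)) * y ^ (∑ j, k j) = x ^ t * (y / x) ^ (∑ j, k j) := by
          rw [Real.rpow_sub hx0, Real.rpow_natCast, div_pow]; ring
      _ ≤ z ^ t * (z ^ θ) ^ (∑ j, k j) := by gcongr
      _ = z ^ (t + θ * (∑ j, k j : ℕ)) := by
          rw [← Real.rpow_natCast, ← Real.rpow_mul hz0.le, ← Real.rpow_add hz0]
      _ ≤ z ^ (t + θ * l) := by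
          refine Real.rpow_le_rpow_of_exponent_le hz1 ?_
          gcongr
  have hP0 : 0 ≤ ∏ j : Fin l, XDeriv ![c, b] ((j : ℕ) + 1) w ^ k j :=
    Finset.prod_nonneg fun j _ => pow_nonneg (XDeriv_nonneg hb hc _ w) _
  rw [iteratedDeriv_rpow_const, ← mul_assoc, abs_mul, abs_mul, abs_of_nonneg hP0,
    abs_of_nonneg (Real.rpow_nonneg hx0.le _)]
  calc _ ≤ |coeffL l k * (descPochhammer ℝ (∑ j, k j)).eval t| * x ^ (t - (∑ j, k j : ℕ)) *
        ((∏ j : Fin l, ((((j : ℕ) + 1).factorial : ℝ) / ρ ^ ((j : ℕ) + 1)) ^ k j) *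
          y ^ (∑ j, k j)) := by gcongr
    _ = |coeffL l k * (descPochhammer ℝ (∑ j, k j)).eval t| *
        (∏ j : Fin l, ((((j : ℕ) + 1).factorial : ℝ) / ρ ^ ((j : ℕ) + 1)) ^ k j) *
          (x ^ (t - (∑ j, k j : ℕ)) * y ^ (∑ j, k j)) := by ring
    _ ≤ _ := by gcongr

/-! ### Measurability and differentiation under the integral sign -/

theorem measurable_XDeriv {lam : Fin 2 → ℝ} (hlam : ∀ i, 0 < lam i) (j : ℕ) :
    Measurable (XDeriv lam j) := by
  have ho : ∀ m, Measurable fun w : ℕ → Fin 2 => ((firstCount w m).choose j : ℝ) := by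
    intro m
    have : (fun w : ℕ → Fin 2 => ((firstCount w m).choose j : ℝ)) = fun w : ℕ → Fin 2 =>
        (((∑ k ∈ Finset.range m, if w k = 0 then 1 else 0 : ℕ).choose j : ℕ) : ℝ) := by
      funext w
      rw [firstCount, Finset.card_filter]
    rw [this]
    refine (measurable_of_countable fun n : ℕ => ((n.choose j : ℕ) : ℝ)).comp ?_
    exact Finset.measurable_fun_sum _ fun k _ =>
      (measurable_of_finite fun i : Fin 2 => if i = 0 then 1 else 0).comp (measurable_pi_apply k)
  exact (measurable_tsum_of_nonneg (fun m => (measurable_weight lam (m + 1)).mul (ho (m + 1)))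
    fun m w => mul_nonneg (weight_pos hlam w _).le (Nat.cast_nonneg _)).const_mul _

theorem measurable_formalDeriv_rpow {lam : Fin 2 → ℝ} (hlam : ∀ i, 0 < lam i) (t : ℝ) (l : ℕ) :
    Measurable (formalDeriv (fun x : ℝ => x ^ t) lam l) := by
  unfold formalDeriv
  simp only [iteratedDeriv_rpow_const]
  refine Finset.measurable_fun_sum _ fun k _ => ?_
  exact ((((measurable_X hlam).pow_const _).const_mul _).const_mul _).mul
    (Finset.measurable_fun_prod _ fun j _ => (measurable_XDeriv hlam _).pow_const _)

theorem contDiffOn_and_iteratedDeriv_of_hasDerivAt {H : ℕ → ℝ → ℝ} {s : Set ℝ} (hs : IsOpen s)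
    (h : ∀ l, ∀ x ∈ s, HasDerivAt (H l) (H (l + 1) x) x) :
    ContDiffOn ℝ ∞ (H 0) s ∧ ∀ l, Set.EqOn (iteratedDeriv l (H 0)) (H l) s := by
  constructor
  · have key : ∀ n l : ℕ, ContDiffOn ℝ n (H l) s := by
      intro n
      induction n with
      | zero =>
        intro l
        exact contDiffOn_zero.2 fun x hx => (h l x hx).continuousAt.continuousWithinAt
      | succ n ih =>
        intro l
        rw [Nat.cast_add_one, contDiffOn_succ_iff_deriv_of_isOpen hs]
        refine ⟨fun x hx => (h l x hx).differentiableAt.differentiableWithinAt,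
          fun hn => absurd hn (by simp), (ih (l + 1)).congr fun x hx => (h l x hx).deriv⟩
    exact contDiffOn_infty.2 fun n => key n 0
  · intro l
    induction l with
    | zero => intro x _; simp
    | succ l ih =>
      intro x hx
      rw [iteratedDeriv_succ, (ih.eventuallyEq_of_mem (hs.mem_nhds hx)).deriv_eq]
      exact (h l x hx).deriv

/-- The inequality of arithmetic and geometric means for `x ^ t` and `y ^ t`. -/
theorem mul_lt_one_of_rpow_add_rpow_lt {x y t : ℝ} (hx : 0 < x) (hy : 0 < y) (ht : 0 < t)
    (h : (x ^ t + y ^ t) / 2 < 1) : x * y < 1 := by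
  by_contra! hxy
  have h1 : 1 ≤ x ^ t * y ^ t := by
    rw [← Real.mul_rpow hx.le hy.le]
    exact Real.one_le_rpow hxy ht.le
  have hx' := Real.rpow_pos_of_pos hx t
  have hy' := Real.rpow_pos_of_pos hy t
  nlinarith [sq_nonneg (x ^ t - y ^ t)]

/-- The moment condition persists for a larger first ratio and a larger exponent. -/
theorem exists_pos_moment_lt {a b t : ℝ} (ha : 0 < a) (hb : 0 < b)
    (h : (a ^ t + b ^ t) / 2 < 1) :
    ∃ p : ℝ, 0 < p ∧ p < a ∧ p < 1 ∧ ((a + 2 * p) ^ (t + p) + b ^ (t + p)) / 2 < 1 := by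
  have hc : ContinuousAt (fun p : ℝ => ((a + 2 * p) ^ (t + p) + b ^ (t + p)) / 2) 0 := by
    refine ContinuousAt.div_const (ContinuousAt.add ?_ ?_) _
    · exact ContinuousAt.rpow (by fun_prop) (by fun_prop) (Or.inl (by simpa using ha.ne'))
    · exact ContinuousAt.rpow (by fun_prop) (by fun_prop) (Or.inl hb.ne')
  have h1 : ∀ᶠ p in 𝓝[>] (0 : ℝ), ((a + 2 * p) ^ (t + p) + b ^ (t + p)) / 2 < 1 :=
    (hc.tendsto.mono_left nhdsWithin_le_nhds).eventually_lt_const (by simpa using h)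
  have h2 : ∀ᶠ p in 𝓝[>] (0 : ℝ), p < a := (gt_mem_nhds ha).filter_mono nhdsWithin_le_nhds
  have h3 : ∀ᶠ p in 𝓝[>] (0 : ℝ), p < 1 := (gt_mem_nhds one_pos).filter_mono nhdsWithin_le_nhds
  obtain ⟨p, ⟨⟨h1, h2⟩, h3⟩, h0⟩ := (((h1.and h2).and h3).and self_mem_nhdsWithin).exists
  exact ⟨p, h0, h2, h3, h1⟩

theorem exists_abs_formalDeriv_le_uniform {a b t p : ℝ} (hb : 0 < b) (ht : 0 < t) (hp : 0 < p)
    (hpa : p < a) (hp1 : p < 1) (l : ℕ) :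
    ∃ C : ℝ, ∀ (w : ℕ → Fin 2), Summable (weight ![a + 2 * p, b] w) →
      ∀ c ∈ Set.Ioo (a - p) (a + p), |formalDeriv (fun x : ℝ => x ^ t) ![c, b] l w| ≤
        C * X ![a + 2 * p, b] w ^ (t + p) := by
  -- This choice gives both `θ * l ≤ p` and `θ ≤ p < 1`.
  set θ : ℝ := p / (l + 1) with hθdef
  have hθ : 0 < θ := by positivity
  have hθp : θ ≤ p := div_le_self hp.le (by linarith [(Nat.cast_nonneg l : (0 : ℝ) ≤ l)])
  have hθl : θ * l ≤ p := by
    rw [hθdef, div_mul_eq_mul_div, div_le_iff₀ (by positivity)]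
    nlinarith
  -- `κ` bounds `(a + 2 * p) / c` from below on the interval, so `c ^ (1 - θ) * (a + 2 * p) ^ θ ≥ c
  -- * κ ^ θ`; as `c > a - p`, the increment `ρ = (a - p) * (κ ^ θ - 1)` works for all `c` at once.
  set κ : ℝ := (a + 2 * p) / (a + p) with hκ
  have hκ1 : 1 < κ := by rw [hκ, one_lt_div (by linarith)]; linarith
  have hκθ : 1 < κ ^ θ := Real.one_lt_rpow hκ1 hθ
  obtain ⟨C, hC⟩ := exists_abs_formalDeriv_le (ρ := (a - p) * (κ ^ θ - 1)) hb ht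
    (mul_pos (by linarith) (by linarith)) hθ (hθp.trans_lt hp1) l
  refine ⟨|C|, fun w hw c hc => ?_⟩
  have hc0 : 0 < c := by linarith [hc.1]
  have hc'0 : 0 < a + 2 * p := by linarith
  refine (hC w c (a + 2 * p) hc0 (by linarith [hc.2]) ?_ hw).trans ?_
  · have e : c ^ (1 - θ) * (a + 2 * p) ^ θ = c * ((a + 2 * p) / c) ^ θ := by
      rw [Real.div_rpow hc'0.le hc0.le, Real.rpow_sub hc0, Real.rpow_one]
      ring
    rw [e]
    have h1 : κ ^ θ ≤ ((a + 2 * p) / c) ^ θ := by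
      refine Real.rpow_le_rpow (by linarith) ?_ hθ.le
      exact div_le_div_of_nonneg_left hc'0.le hc0 hc.2.le
    nlinarith [mul_le_mul_of_nonneg_left h1 hc0.le,
      mul_le_mul_of_nonneg_right hc.1.le (sub_nonneg.2 hκθ.le)]
  · have hz := one_le_X (pair_pos hc'0 hb) hw
    refine mul_le_mul (le_abs_self C) (Real.rpow_le_rpow_of_exponent_le hz (by linarith))
      (by positivity) (abs_nonneg C)

theorem hasDerivAt_formalDeriv {b c ρ : ℝ} (hb : 0 < b) (hc : 0 < c) (hρ : 0 < ρ) {w : ℕ → Fin 2}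
    (hw : Summable (weight ![c + ρ, b] w)) (t : ℝ) (l : ℕ) :
    HasDerivAt (fun c => formalDeriv (fun x : ℝ => x ^ t) ![c, b] l w)
      (formalDeriv (fun x : ℝ => x ^ t) ![c, b] (l + 1) w) c := by
  have ha := analyticAt_X_rpow hb hc hρ hw t
  have hd : DifferentiableAt ℝ (iteratedDeriv l fun c => X ![c, b] w ^ t) c := by
    rw [iteratedDeriv_eq_iterate]
    exact (ha.iterated_deriv l).differentiableAt
  have h := hd.hasDerivAt
  rw [← iteratedDeriv_succ, iteratedDeriv_X_rpow hb hc hρ hw] at h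
  refine h.congr_of_eventuallyEq ?_
  -- For `d` near `c` the radius `c + ρ - d` leads to the same endpoint `c + ρ`, so the summability
  -- hypothesis is reused.
  filter_upwards [Ioo_mem_nhds hc (show c < c + ρ by linarith)] with d hd
  refine (iteratedDeriv_X_rpow (ρ := c + ρ - d) hb hd.1 (by linarith [hd.2]) ?_ t l).symm
  rwa [add_sub_cancel]

/-- Differentiation under the integral sign for the moments of the projection. -/
theorem integrable_formalDeriv_and_hasDerivAt_integral {a b t p : ℝ} (hb : 0 < b) (ht : 0 < t)
    (hp : 0 < p) (hpa : p < a) (hp1 : p < 1)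
    (hm : ((a + 2 * p) ^ (t + p) + b ^ (t + p)) / 2 < 1) (l : ℕ) :
    ∀ c ∈ Set.Ioo (a - p) (a + p),
      Integrable (formalDeriv (fun x : ℝ => x ^ t) ![c, b] l) bernoulli ∧
      HasDerivAt (fun c => ∫ w, formalDeriv (fun x : ℝ => x ^ t) ![c, b] l w ∂bernoulli)
        (∫ w, formalDeriv (fun x : ℝ => x ^ t) ![c, b] (l + 1) w ∂bernoulli) c := by
  have hc' : 0 < a + 2 * p := by linarith
  obtain ⟨hsum, hint⟩ := ae_summable_weight_and_integrable_X_rpow (pair_pos hc' hb)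
    (show 0 < t + p by linarith) (by simpa using hm)
  have hmeas : ∀ l, ∀ c ∈ Set.Ioo (a - p) (a + p), AEStronglyMeasurable
      (formalDeriv (fun x : ℝ => x ^ t) ![c, b] l) bernoulli := fun l c hc =>
    (measurable_formalDeriv_rpow (pair_pos (by linarith [hc.1]) hb) t l).aestronglyMeasurable
  have hI : ∀ c ∈ Set.Ioo (a - p) (a + p),
      Integrable (formalDeriv (fun x : ℝ => x ^ t) ![c, b] l) bernoulli := by
    intro c hc
    obtain ⟨C, hC⟩ := exists_abs_formalDeriv_le_uniform (t := t) hb ht hp hpa hp1 l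
    exact (hint.const_mul C).mono' (hmeas l c hc) (hsum.mono fun w hw => hC w hw c hc)
  intro c hc
  refine ⟨hI c hc, ?_⟩
  obtain ⟨C, hC⟩ := exists_abs_formalDeriv_le_uniform (t := t) hb ht hp hpa hp1 (l + 1)
  have hnhds := Ioo_mem_nhds hc.1 hc.2
  refine (hasDerivAt_integral_of_dominated_loc_of_deriv_le
    (F := fun c w => formalDeriv (fun x : ℝ => x ^ t) ![c, b] l w)
    (F' := fun c w => formalDeriv (fun x : ℝ => x ^ t) ![c, b] (l + 1) w)
    (bound := fun w => C * X ![a + 2 * p, b] w ^ (t + p)) hnhds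
    (mem_of_superset hnhds (hmeas l)) (hI c hc) (hmeas (l + 1) c hc)
    (hsum.mono fun w hw => hC w hw) (hint.const_mul C) ?_).2
  filter_upwards [hsum] with w hw d hd
  refine hasDerivAt_formalDeriv (ρ := a + 2 * p - d) hb (by linarith [hd.1]) (by linarith [hd.2])
    ?_ t l
  rwa [add_sub_cancel]

end LinearResponse

/-! ### The main theorem -/

open LinearResponse in
theorem mainTheorem3 (lam₁ lam₂ t : ℝ) (hpos : 0 < lam₁) (hlt : lam₁ < 1) (hgt : 1 < lam₂)
    (ht : 0 < t) (hmoment : (lam₁ ^ t + lam₂ ^ t) / 2 < 1) :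
    -- the system is contracting on average and the stationary measures are well defined
    lam₁ * lam₂ < 1 ∧
    (∀ ε : ℝ, 0 < lam₁ + ε → (lam₁ + ε) * lam₂ < 1 →
      ∃! μ : Measure ℝ, LinearResponse.IsStationary ![lam₁ + ε, lam₂] μ) ∧
    -- for almost every word the series for `X(ε)` and its formal derivatives converge,
    -- and `X(ε)` is smooth at `0` with these derivatives
    (∀ᵐ w ∂LinearResponse.bernoulli,
      (∀ ε : ℝ, 0 < lam₁ + ε → (lam₁ + ε) * lam₂ < 1 →
        Summable fun m : ℕ => LinearResponse.weight ![lam₁ + ε, lam₂] w m) ∧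
      ContDiffAt ℝ ∞ (fun ε : ℝ => LinearResponse.X ![lam₁ + ε, lam₂] w) 0 ∧
      ∀ j : ℕ, 1 ≤ j →
        (Summable fun m : ℕ => LinearResponse.weight ![lam₁, lam₂] w (m + 1) *
          ((LinearResponse.firstCount w (m + 1)).choose j : ℝ)) ∧
        iteratedDeriv j (fun ε : ℝ => LinearResponse.X ![lam₁ + ε, lam₂] w) 0 =
          LinearResponse.XDeriv ![lam₁, lam₂] j w) ∧
    -- linear response for the `t`-th moment
    ∀ μ : ℝ → Measure ℝ,
      (∀ᶠ ε in 𝓝 (0 : ℝ), LinearResponse.IsStationary ![lam₁ + ε, lam₂] (μ ε)) →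
      (∀ᶠ ε in 𝓝 (0 : ℝ),
        (∀ᵐ x ∂μ ε, 1 ≤ x) ∧ Integrable (fun x : ℝ => x ^ t) (μ ε)) ∧
      ContDiffAt ℝ ∞ (fun ε : ℝ => ∫ x, x ^ t ∂μ ε) 0 ∧
      ∀ l : ℕ,
        (∀ᵐ w ∂LinearResponse.bernoulli,
          iteratedDeriv l (fun ε : ℝ => LinearResponse.X ![lam₁ + ε, lam₂] w ^ t) 0 =
            LinearResponse.formalDeriv (fun x : ℝ => x ^ t) ![lam₁, lam₂] l w) ∧
        Integrable (fun w => iteratedDeriv l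
          (fun ε : ℝ => LinearResponse.X ![lam₁ + ε, lam₂] w ^ t) 0)
          LinearResponse.bernoulli ∧
        Integrable (LinearResponse.formalDeriv (fun x : ℝ => x ^ t) ![lam₁, lam₂] l)
          LinearResponse.bernoulli ∧
        iteratedDeriv l (fun ε : ℝ => ∫ x, x ^ t ∂μ ε) 0 =
          ∫ w, iteratedDeriv l
            (fun ε : ℝ => LinearResponse.X ![lam₁ + ε, lam₂] w ^ t) 0
            ∂LinearResponse.bernoulli ∧
        iteratedDeriv l (fun ε : ℝ => ∫ x, x ^ t ∂μ ε) 0 =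
          ∫ w, LinearResponse.formalDeriv (fun x : ℝ => x ^ t) ![lam₁, lam₂] l w
            ∂LinearResponse.bernoulli := by
  have hb : 0 < lam₂ := one_pos.trans hgt
  have hab : lam₁ * lam₂ < 1 := mul_lt_one_of_rpow_add_rpow_lt hpos hb ht hmoment
  have hgood := ae_forall_summable_weight hb
  obtain ⟨ρ, hρ, hρb⟩ : ∃ ρ, 0 < ρ ∧ (lam₁ + ρ) * lam₂ < 1 := by
    obtain ⟨d, hd, hdb⟩ := exists_between ((lt_div_iff₀ hb).2 hab)
    exact ⟨d - lam₁, sub_pos.2 hd, by rwa [add_sub_cancel, ← lt_div_iff₀ hb]⟩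
  have hρw : ∀ᵐ w ∂LinearResponse.bernoulli, Summable (weight ![lam₁ + ρ, lam₂] w) :=
    hgood.mono fun w hw => hw _ (by positivity) hρb
  refine ⟨hab, fun ε hε hεb => existsUnique_isStationary (pair_pos hε hb) (by simpa using hεb),
    ?_, ?_⟩
  · filter_upwards [hgood, hρw] with w hw hwρ
    refine ⟨fun ε hε hεb => hw _ hε hεb, ?_, fun j hj => ?_⟩
    · have h : AnalyticAt ℝ (fun c => X ![c, lam₂] w) (lam₁ + 0) := by
        simpa using analyticAt_X hb hpos hρ hwρ
      exact (AnalyticAt.fun_comp (f := fun ε : ℝ => lam₁ + ε) h (by fun_prop)).contDiffAt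
    · obtain ⟨h1, h2⟩ := XDeriv_eq_factorial_mul_XCoeff hb hpos hρ hwρ hj
      refine ⟨h1, ?_⟩
      rw [iteratedDeriv_comp_const_add j (fun c => X ![c, lam₂] w) lam₁, h2]
      simpa using iteratedDeriv_X hb hpos hρ hwρ j
  intro μ hμ
  obtain ⟨p, hp, hpa, hp1, hm⟩ := exists_pos_moment_lt hpos hb hmoment
  have hderiv := integrable_formalDeriv_and_hasDerivAt_integral hb ht hp hpa hp1 hm
  -- The integrals of `formalDeriv` of order `l = 0, 1, 2, …` form a chain in which each is the
  -- derivative of the preceding one on a whole interval.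
  obtain ⟨hsmooth, hiter⟩ := contDiffOn_and_iteratedDeriv_of_hasDerivAt isOpen_Ioo
    fun l c hc => (hderiv l c hc).2
  have hmem : lam₁ ∈ Set.Ioo (lam₁ - p) (lam₁ + p) := ⟨by linarith, by linarith⟩
  have hpb : (lam₁ + 2 * p) * lam₂ < 1 :=
    mul_lt_one_of_rpow_add_rpow_lt (by linarith) hb (by linarith) hm
  have hpow : Measurable fun x : ℝ => x ^ t := measurable_id.pow_const t
  have hzero : ∀ c : ℝ, ∀ w, formalDeriv (fun x : ℝ => x ^ t) ![c, lam₂] 0 w =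
      X ![c, lam₂] w ^ t := by
    intro c w
    have : tuples 0 = {fun _ => 0} := by
      ext k
      simp [mem_tuples, eq_iff_true_of_subsingleton]
    simp [formalDeriv, this, coeffL]
  have hlaw : ∀ᶠ ε in 𝓝 (0 : ℝ), lam₁ + ε ∈ Set.Ioo (lam₁ - p) (lam₁ + p) ∧
      (lam₁ + ε) * lam₂ < 1 ∧ μ ε = LinearResponse.bernoulli.map (X ![lam₁ + ε, lam₂]) := by
    filter_upwards [hμ, Ioo_mem_nhds (neg_lt_zero.2 hp) hp] with ε hε hεp
    have hεb : (lam₁ + ε) * lam₂ < 1 := by nlinarith [hεp.2]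
    exact ⟨⟨by linarith [hεp.1], by linarith [hεp.2]⟩, hεb,
      hε.eq_map_X (pair_pos (by linarith [hεp.1]) hb) (by simpa using hεb)⟩
  -- Equality near `0` suffices: smoothness and derivatives at `0` depend only on the germ, so `μ ε`
  -- may be arbitrary for other `ε`.
  have hH : (fun ε : ℝ => ∫ x, x ^ t ∂μ ε) =ᶠ[𝓝 0] fun ε => ∫ w,
      formalDeriv (fun x : ℝ => x ^ t) ![lam₁ + ε, lam₂] 0 w ∂LinearResponse.bernoulli := by
    filter_upwards [hlaw] with ε hε
    rw [hε.2.2, integral_map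
      (measurable_X (pair_pos (show 0 < lam₁ + ε by linarith [hε.1.1]) hb)).aemeasurable
      hpow.aestronglyMeasurable]
    simp only [hzero]
  have hformal : ∀ l, ∀ᵐ w ∂LinearResponse.bernoulli,
      iteratedDeriv l (fun ε : ℝ => X ![lam₁ + ε, lam₂] w ^ t) 0 =
        formalDeriv (fun x : ℝ => x ^ t) ![lam₁, lam₂] l w := by
    intro l
    filter_upwards [hρw] with w hw
    rw [iteratedDeriv_comp_const_add l (fun c => X ![c, lam₂] w ^ t) lam₁]
    simpa using iteratedDeriv_X_rpow hb hpos hρ hw t l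
  have hint : ∀ l, iteratedDeriv l (fun ε : ℝ => ∫ x, x ^ t ∂μ ε) 0 =
      ∫ w, formalDeriv (fun x : ℝ => x ^ t) ![lam₁, lam₂] l w ∂LinearResponse.bernoulli := by
    intro l
    rw [hH.iteratedDeriv_eq l, iteratedDeriv_comp_const_add l (fun c => ∫ w,
      formalDeriv (fun x : ℝ => x ^ t) ![c, lam₂] 0 w ∂LinearResponse.bernoulli) lam₁]
    simpa using hiter l hmem
  refine ⟨?_, ?_, fun l => ⟨hformal l, ((hderiv l _ hmem).1).congr ((hformal l).mono
    fun w hw => hw.symm), (hderiv l _ hmem).1, ?_, hint l⟩⟩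
  · filter_upwards [hlaw] with ε ⟨hε, hεb, hμε⟩
    have hlam := pair_pos (show 0 < lam₁ + ε by linarith [hε.1]) hb
    have hX := (measurable_X hlam).aemeasurable (μ := LinearResponse.bernoulli)
    rw [hμε]
    constructor
    · rw [ae_map_iff hX measurableSet_Ici]
      exact (ae_summable_weight hlam (by simpa using hεb)).mono fun w hw => one_le_X hlam hw
    · rw [integrable_map_measure hpow.aestronglyMeasurable hX]
      refine ((hderiv 0 _ hε).1).congr (Eventually.of_forall fun w => ?_)
      simp [hzero]
  · refine ContDiffAt.congr_of_eventuallyEq ?_ hH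
    have h : ContDiffAt ℝ ∞ (fun c => ∫ w,
        formalDeriv (fun x : ℝ => x ^ t) ![c, lam₂] 0 w ∂LinearResponse.bernoulli) (lam₁ + 0) := by
      simpa using hsmooth.contDiffAt (Ioo_mem_nhds hmem.1 hmem.2)
    exact h.comp (0 : ℝ) (f := fun ε => lam₁ + ε) (by fun_prop)
  · rw [hint l]
    exact integral_congr_ae ((hformal l).mono fun w hw => hw.symm)
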